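/- Let $\Bbbk$ be a field of characteristic zero and let $\mathcal{C}$ be a small skeletal EI-category (every endomorphism is an isomorphism) which is inwards finite (for each object $j$ there are only finitely many objects $i$ with $\mathcal{C}(i,j)\neq\emptyset$) and hom-finite (every set $\mathcal{C}(i,j)$ is finite). A left (respectively right) $\mathcal{C}$-module is a covariant (respectively contravariant) functor from $\mathcal{C}$ to $\Bbbk$-vector spaces; it is finitely generated if it is generated by finitely many elements of its values, and finite-dimensional if the direct sum of its values is finite-dimensional. Let $\mathcal{C}\text{-mod}$ be the category of finitely generated left $\mathcal{C}$-modules and $\mathcal{C}\text{-fdmod}$ its full subcategory of finite-dimensional modules. Assume that $\mathcal{C}$ is locally noetherian over $\Bbbk$, i.e. every submodule of a finitely generated left $\mathcal{C}$-module is finitely generated. For an object $i$ let $Ae_i=\Bbbk\,\mathcal{C}(i,-)$, and let $A=\bigoplus_i Ae_i$ be the category algebra. For a finitely generated left $\mathcal{C}$-module $V$, let $\operatorname{Hom}_{\mathcal{C}}(V,A)$ be the right $\mathcal{C}$-module $i\mapsto \operatorname{Hom}_{\mathcal{C}}(V,Ae_i)$, which is finite-dimensional, let $D=\operatorname{Hom}_{\Bbbk}(-,\Bbbk)$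 be the duality from finite-dimensional right modules to finite-dimensional left modules, and let $$\nu = D\circ\operatorname{Hom}_{\mathcal{C}}(-,A):\ \mathcal{C}\text{-mod}\longrightarrow\mathcal{C}\text{-fdmod}$$ be the Nakayama functor. Suppose that $\mathcal{C}$ is locally self-injective, i.e. $Ae_i$ is an injective left $\mathcal{C}$-module for every object $i$ (equivalently, every finitely generated projective left $\mathcal{C}$-module is injective). Then the full subcategory $\operatorname{Ker}(\nu)=\{V : \nu(V)=0\}$ is a Serre subcategory of the abelian category $\mathcal{C}\text{-mod}$, and $\nu$ induces an equivalence of categories $$\overline{\nu}:\ \mathcal{C}\text{-mod}/\operatorname{Ker}(\nu)\ \xrightarrow{\ \sim\ }\ \mathcal{C}\text{-fdmod}$$ from the Serre quotient, that is, an equivalence whose composite with the quotient functor $\mathcal{C}\text{-mod}\to\mathcal{C}\text{-mod}/\operatorname{Ker}(\nu)$ is isomorphic to $\nu$. -/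

import Mathlib

open CategoryTheory CategoryTheory.Limits Opposite

universe u

namespace EICat

/-! ### Conditions on a small category -/

/-- Every endomorphism is an isomorphism. -/
def IsEI (C : Type u) [SmallCategory C] : Prop :=
  ∀ (i : C) (f : i ⟶ i), IsIso f

/-- For each object `j` there are only finitely many `i` with `C(i, j)` nonempty. -/
class InwardsFinite (C : Type u) [SmallCategory C] : Prop where
  finite_le : ∀ j : C, {i : C | Nonempty (i ⟶ j)}.Finite

/-- Every hom-set is finite. -/
class HomFinite (C : Type u) [SmallCategory C] : Prop where
  finite_hom : ∀ i j : C, Finite (i ⟶ j)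

section Modules

variable (k : Type u) [Field k] (C : Type u) [SmallCategory C]

/-- A left `C`-module over `k` is a covariant functor from `C` to `k`-vector spaces;
a right `C`-module is an object of `CMod k Cᵒᵖ`. -/
abbrev CMod : Type (u + 1) := C ⥤ ModuleCat.{u} k

/-- A module is finitely generated if there are finitely many elements `v s ∈ V (j s)` such that
each `V i` is spanned by the images of the `v s` under the morphisms `j s ⟶ i` of `C`. -/
def isFG : ObjectProperty (CMod k C) := fun V =>
  ∃ (ι : Type) (_ : Finite ι) (j : ι → C) (v : ∀ s, V.obj (j s)),
    ∀ i : C, Submodule.span k {x : V.obj i | ∃ (s : ι) (f : j s ⟶ i), V.map f (v s) = x} = ⊤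

/-- A module is finite-dimensional if `⨁ i, V i` is a finite-dimensional vector space: every `V i`
is finite-dimensional and all but finitely many of them vanish. -/
def isFD : ObjectProperty (CMod k C) := fun V =>
  (∀ i : C, Module.Finite k (V.obj i)) ∧ {i : C | Nontrivial (V.obj i)}.Finite

/-- Every submodule of a finitely generated left `C`-module is finitely generated. -/
class LocallyNoetherian : Prop where
  fg_of_mono : ∀ {W V : CMod k C} (f : W ⟶ V) [Mono f], isFG k C V → isFG k C W

/-- The category of finitely generated `C`-modules. -/
abbrev FGMod : Type (u + 1) := (isFG k C).FullSubcategory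

/-- The category of finite-dimensional `C`-modules. -/
abbrev FDMod : Type (u + 1) := (isFD k C).FullSubcategory

/-! ### Finitely generated modules form an abelian category -/

variable {k C}

lemma isFG_of_epi {V W : CMod k C} (f : V ⟶ W) [Epi f] (hV : isFG k C V) : isFG k C W := by
  obtain ⟨ι, hι, j, v, h⟩ := hV
  refine ⟨ι, hι, j, fun s => f.app (j s) (v s), fun i => ?_⟩
  have hs : Function.Surjective (f.app i).hom :=
    (ModuleCat.epi_iff_surjective _).1 inferInstance
  rw [← LinearMap.range_eq_top.2 hs, LinearMap.range_eq_map, ← h i, Submodule.map_span]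
  congr 1
  ext x
  constructor
  · rintro ⟨s, g, rfl⟩
    exact ⟨_, ⟨s, g, rfl⟩, NatTrans.naturality_apply f g (v s)⟩
  · rintro ⟨_, ⟨s, g, rfl⟩, rfl⟩
    exact ⟨s, g, (NatTrans.naturality_apply f g (v s)).symm⟩

lemma isFG_of_isZero {V : CMod k C} (hV : IsZero V) : isFG k C V := by
  refine ⟨PEmpty, inferInstance, PEmpty.elim, fun s => s.elim, fun i => ?_⟩
  have : Subsingleton (V.obj i) :=
    ModuleCat.subsingleton_of_isZero ((Functor.isZero_iff V).1 hV i)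
  exact Subsingleton.elim _ _

lemma isFG_biprod {V W : CMod k C} (hV : isFG k C V) (hW : isFG k C W) :
    isFG k C (V ⊞ W) := by
  obtain ⟨ι, hι, j, v, h⟩ := hV
  obtain ⟨ι', hι', j', v', h'⟩ := hW
  refine ⟨ι ⊕ ι', inferInstance, Sum.elim j j',
    fun s => match s with
      | .inl s => (biprod.inl : V ⟶ V ⊞ W).app (j s) (v s)
      | .inr s => (biprod.inr : W ⟶ V ⊞ W).app (j' s) (v' s), fun i => ?_⟩
  rw [eq_top_iff]
  rintro x -
  have hx : x = (biprod.inl : V ⟶ V ⊞ W).app i ((biprod.fst : V ⊞ W ⟶ V).app i x) +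
      (biprod.inr : W ⟶ V ⊞ W).app i ((biprod.snd : V ⊞ W ⟶ W).app i x) := by
    have e := congrArg (fun φ : V ⊞ W ⟶ V ⊞ W => (φ.app i).hom x)
      (biprod.total (X := V) (Y := W))
    exact e.symm
  rw [hx]
  refine Submodule.add_mem _ ?_ ?_
  · have hy : (biprod.fst : V ⊞ W ⟶ V).app i x ∈ (⊤ : Submodule k (V.obj i)) := trivial
    rw [← h i] at hy
    have := Submodule.mem_map_of_mem (f := ((biprod.inl : V ⟶ V ⊞ W).app i).hom) hy
    rw [Submodule.map_span] at this
    refine Submodule.span_mono ?_ this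
    rintro _ ⟨_, ⟨s, g, rfl⟩, rfl⟩
    exact ⟨.inl s, g, (NatTrans.naturality_apply (biprod.inl : V ⟶ V ⊞ W) g (v s)).symm⟩
  · have hy : (biprod.snd : V ⊞ W ⟶ W).app i x ∈ (⊤ : Submodule k (W.obj i)) := trivial
    rw [← h' i] at hy
    have := Submodule.mem_map_of_mem (f := ((biprod.inr : W ⟶ V ⊞ W).app i).hom) hy
    rw [Submodule.map_span] at this
    refine Submodule.span_mono ?_ this
    rintro _ ⟨_, ⟨s, g, rfl⟩, rfl⟩
    exact ⟨.inr s, g, (NatTrans.naturality_apply (biprod.inr : W ⟶ V ⊞ W) g (v' s)).symm⟩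

instance : (isFG k C).IsClosedUnderQuotients where
  prop_of_epi f _ h := isFG_of_epi f h

instance [LocallyNoetherian k C] : (isFG k C).IsClosedUnderSubobjects where
  prop_of_mono f _ h := LocallyNoetherian.fg_of_mono f h

instance : (isFG k C).ContainsZero where
  exists_zero := ⟨_, isZero_zero _, isFG_of_isZero (isZero_zero _)⟩

instance : (isFG k C).IsClosedUnderBinaryProducts where
  limitsOfShape_le := by
    rintro X ⟨p⟩
    have e : X ≅ p.diag.obj ⟨.left⟩ ⊞ p.diag.obj ⟨.right⟩ :=
      (IsLimit.conePointsIsoOfNatIso p.isLimit (BinaryBiproduct.isLimit _ _)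
        (diagramIsoPair p.diag))
    exact isFG_of_epi e.inv (isFG_biprod (p.prop_diag_obj _) (p.prop_diag_obj _))

instance : (isFG k C).IsClosedUnderFiniteProducts :=
  ObjectProperty.IsClosedUnderFiniteProducts.mk'

noncomputable instance [LocallyNoetherian k C] : Abelian (FGMod k C) := inferInstance

/-- A finite-dimensional module is finitely generated, so `FDMod k C` is a full subcategory of
`FGMod k C`. -/
lemma isFD_le_isFG : isFD k C ≤ isFG k C := by
  rintro V ⟨h₁, h₂⟩
  have hS : Finite {i : C | Nontrivial (V.obj i)} := h₂
  obtain ⟨n, ⟨e⟩⟩ := Finite.exists_equiv_fin {i : C | Nontrivial (V.obj i)}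
  refine ⟨Σ t : Fin n, Fin (Module.finrank k (V.obj (e.symm t).1)), inferInstance,
    fun s => (e.symm s.1).1, fun s => Module.finBasis k (V.obj (e.symm s.1).1) s.2, fun i => ?_⟩
  by_cases hi : Nontrivial (V.obj i)
  · obtain ⟨t, ht⟩ := e.symm.surjective ⟨i, hi⟩
    obtain rfl : (e.symm t).1 = i := congrArg Subtype.val ht
    rw [eq_top_iff, ← (Module.finBasis k (V.obj (e.symm t).1)).span_eq]
    refine Submodule.span_mono ?_
    rintro _ ⟨b, rfl⟩
    exact ⟨⟨t, b⟩, 𝟙 _, by simp⟩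
  · have := not_nontrivial_iff_subsingleton.1 hi
    exact Subsingleton.elim _ _

/-! ### The Nakayama functor -/

variable (k C)

/-- The category algebra `A` as a bimodule: `(Ae).obj (op i)` is the left module
`A e_i = (j ↦ k C(i, j))`, and a morphism `i ⟶ i'` acts by right multiplication
`A e_{i'} ⟶ A e_i`. -/
noncomputable def Ae : Cᵒᵖ ⥤ CMod k C :=
  coyoneda ⋙ (Functor.whiskeringRight C (Type u) (ModuleCat.{u} k)).obj (ModuleCat.free k)

/-- `C` is locally self-injective over `k` if each `A e_i` is an injective left `C`-module. -/
def IsLocallySelfInjective : Prop :=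
  ∀ i : C, Injective ((Ae k C).obj (op i))

/-- The contravariant functor `Hom_C(-, A)` from left modules to right modules, where
`Hom_C(V, A)` is the graded right module `⨁ i, Hom_C(V, A e_i)`, i.e. the contravariant functor
`i ↦ Hom_C(V, A e_i)`. -/
noncomputable def homA : (CMod k C)ᵒᵖ ⥤ CMod k Cᵒᵖ :=
  linearCoyoneda k (CMod k C) ⋙ (Functor.whiskeringLeft Cᵒᵖ (CMod k C) (ModuleCat.{u} k)).obj (Ae k C)

/-- The duality `D = Hom_k(-, k)` from right modules to left modules: `(D W) i` is the dual vector
space of `W i`. -/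
def dual : (CMod k Cᵒᵖ)ᵒᵖ ⥤ CMod k C where
  obj W :=
    { obj := fun i => ModuleCat.of k (Module.Dual k (W.unop.obj (op i)))
      map := fun f => ModuleCat.ofHom (W.unop.map f.op).hom.dualMap
      map_id := fun i => by ext; simp
      map_comp := fun f g => by ext; simp }
  map φ :=
    { app := fun i => ModuleCat.ofHom (φ.unop.app (op i)).hom.dualMap
      naturality := fun i j f => by
        have h := φ.unop.naturality f.op
        ext x y
        exact congrArg x (congrArg (fun t => t.hom y) h).symm }

variable {k C}

lemma isFD_homA [InwardsFinite C] [HomFinite C] {V : CMod k C} (hV : isFG k C V) :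
    isFD k Cᵒᵖ ((homA k C).obj (op V)) := by
  obtain ⟨ι, hι, j, v, h⟩ := hV
  have ext' : ∀ (i : Cᵒᵖ) (φ ψ : V ⟶ (Ae k C).obj i),
      (∀ s, φ.app (j s) (v s) = ψ.app (j s) (v s)) → φ = ψ := by
    intro i φ ψ hs
    ext l : 2
    apply ModuleCat.hom_ext
    apply LinearMap.ext_on (h l)
    rintro _ ⟨s, f, rfl⟩
    have e₁ := NatTrans.naturality_apply φ f (v s)
    have e₂ := NatTrans.naturality_apply ψ f (v s)
    rw [hs s] at e₁
    exact e₁.trans e₂.symm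
  constructor
  · intro i
    have hf : ∀ s, Module.Finite k (((Ae k C).obj i).obj (j s)) := fun s => by
      have := HomFinite.finite_hom i.unop (j s)
      exact (inferInstance : Module.Finite k ((i.unop ⟶ j s) →₀ k))
    let F : (V ⟶ (Ae k C).obj i) →ₗ[k] (∀ s, ((Ae k C).obj i).obj (j s)) :=
      { toFun := fun φ s => φ.app (j s) (v s)
        map_add' := fun _ _ => rfl
        map_smul' := fun _ _ => rfl }
    exact Module.Finite.of_injective F (fun φ ψ e => ext' i φ ψ (congrFun e))
  · have hfin : (⋃ s, {i : C | Nonempty (i ⟶ j s)}).Finite :=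
      Set.finite_iUnion fun s => InwardsFinite.finite_le (j s)
    refine (hfin.image op).subset fun i hi => ?_
    refine ⟨i.unop, ?_, rfl⟩
    by_contra hcon
    simp only [Set.mem_iUnion, Set.mem_ofPred_eq, not_exists, not_nonempty_iff] at hcon
    have hsub : Subsingleton (V ⟶ (Ae k C).obj i) := ⟨fun φ ψ => ext' i φ ψ fun s => by
      have := hcon s
      have : Subsingleton (((Ae k C).obj i).obj (j s)) :=
        (inferInstance : Subsingleton ((i.unop ⟶ j s) →₀ k))
      exact Subsingleton.elim _ _⟩
    exact not_subsingleton_iff_nontrivial.2 hi hsub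

lemma isFD_dual {W : CMod k Cᵒᵖ} (hW : isFD k Cᵒᵖ W) : isFD k C ((dual k C).obj (op W)) := by
  constructor
  · intro i
    have := hW.1 (op i)
    exact (inferInstance : Module.Finite k (Module.Dual k (W.obj (op i))))
  · refine (hW.2.image unop).subset fun i hi => ⟨op i, ?_, rfl⟩
    by_contra hcon
    have hs : Subsingleton (W.obj (op i)) := not_nontrivial_iff_subsingleton.1 hcon
    exact not_subsingleton_iff_nontrivial.2 hi
      (inferInstance : Subsingleton (Module.Dual k (W.obj (op i))))

variable (k C)

/-- `Hom_C(-, A)` from finitely generated left modules to finite-dimensional right modules. -/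
noncomputable def homAFG [InwardsFinite C] [HomFinite C] : (FGMod k C)ᵒᵖ ⥤ FDMod k Cᵒᵖ :=
  (isFD k Cᵒᵖ).lift ((isFG k C).ι.op ⋙ homA k C) fun V => isFD_homA V.unop.property

/-- The duality from finite-dimensional right modules to finite-dimensional left modules. -/
def dualFD : (FDMod k Cᵒᵖ)ᵒᵖ ⥤ FDMod k C :=
  (isFD k C).lift ((isFD k Cᵒᵖ).ι.op ⋙ dual k C) fun W => isFD_dual W.unop.property

/-- The Nakayama functor `ν = D ∘ Hom_C(-, A)` from finitely generated to finite-dimensional left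
`C`-modules. -/
noncomputable def nakayama [InwardsFinite C] [HomFinite C] : FGMod k C ⥤ FDMod k C :=
  (homAFG k C).rightOp ⋙ dualFD k C

end Modules

/-- The Serre quotient of an abelian category by a Serre subcategory `P`: the localization at the
morphisms whose kernel and cokernel lie in `P`. -/
abbrev SerreQuotient {A : Type*} [Category* A] [Abelian A] (P : ObjectProperty A)
    [P.IsSerreClass] := P.isoModSerre.Localization

/-- The quotient functor to the Serre quotient. -/
abbrev toSerreQuotient {A : Type*} [Category* A] [Abelian A] (P : ObjectProperty A)
    [P.IsSerreClass] : A ⥤ SerreQuotient P := P.isoModSerre.Q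

end EICat

/-! An exact functor `F` between abelian categories with a fully faithful right adjoint is a Serre
quotient by its kernel. Self-injectivity makes each `Hom_C(-, A e_i)` exact, and `D` is exact, so
`ν` is exact; in particular its kernel is a Serre class.

The right adjoint is built from closed objects, those `X` with `Hom(V, X) → Hom(F V, F X)` bijective
for all `V`: it is enough that every `W` in the target is `F X` with `X` closed. Closed objects are
stable under limits that `F` preserves, so by exactness it even suffices to embed every `W` into
some `F X`, and then present `W` as a kernel (`isLocalization_isoModSerre_kernel`).

For `ν` the closed objects are finite products of the `A e_j`. A morphism `W ⟶ ν (A e_j)` amounts to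
a linear form on `W j`; for `W = ν V` this is an element of the double dual of the
finite-dimensional space `Hom_C(V, A e_j)` (`map_dualHomA_bijective`). The coordinate forms of bases
of the spaces `W j` give the embedding (`exists_mono_nakayama`). -/

namespace EICat

/-! ### Serre quotient functors from closed objects -/

section Localization

variable {A B : Type*} [Category* A] [Category* B] (F : A ⥤ B)

/-- An object `X` is closed for `F` if `F` induces bijections `Hom(V, X) → Hom(F V, F X)`. -/
def IsClosedFor (X : A) : Prop :=
  ∀ V : A, Function.Bijective (fun f : V ⟶ X => F.map f)

variable {F}

/-- Maps into a limit are compatible families of maps, both before and after applying `F`, so the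
bijections for the `K.obj j` assemble to one for the limit. -/
lemma IsClosedFor.of_isLimit {J : Type*} [Category* J] {K : J ⥤ A}
    (hK : ∀ j, IsClosedFor F (K.obj j)) {c : Cone K} (hc : IsLimit c)
    (hc' : IsLimit (F.mapCone c)) : IsClosedFor F c.pt := by
  refine fun V => ⟨fun f g h => hc.hom_ext fun j => (hK j V).1 ?_, fun φ => ?_⟩
  · dsimp only at h ⊢
    rw [F.map_comp, F.map_comp, h]
  · choose f hf using fun j => (hK j V).2 (φ ≫ F.map (c.π.app j))
    dsimp only at hf
    let s : Cone K :=
      { pt := V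
        π :=
          { app := f
            -- Compatibility of the lifted family is checked after applying `F`, which is injective
            -- on maps into `K.obj j`.
            naturality := fun i j g => (hK j V).1 (by
              dsimp only [Functor.const_obj_obj, Functor.const_obj_map]
              rw [Category.id_comp, F.map_comp, hf, hf, Category.assoc, ← F.map_comp, c.w]) } }
    refine ⟨hc.lift s, hc'.hom_ext fun j => ?_⟩
    change F.map (hc.lift s) ≫ F.map (c.π.app j) = φ ≫ F.map (c.π.app j)
    rw [← F.map_comp, hc.fac, ← hf]

/-- A functor for which every object of the target is the image of a closed object has a fully
faithful right adjoint. -/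
lemma exists_adjunction_of_isClosedFor
    (h : ∀ W : B, ∃ X : A, IsClosedFor F X ∧ Nonempty (F.obj X ≅ W)) :
    ∃ (G : B ⥤ A) (_ : F ⊣ G), G.Full ∧ G.Faithful := by
  choose G hG e using h
  let e' (V : A) (W : B) : (F.obj V ⟶ W) ≃ (V ⟶ G W) :=
    ((e W).some.homToEquiv.symm).trans (Equiv.ofBijective _ (hG W V)).symm
  have he' (V : A) (W : B) (f : V ⟶ G W) : (e' V W).symm f = F.map f ≫ (e W).some.hom := rfl
  have nat : ∀ X' X Y f g, e' X' Y (F.map f ≫ g) = f ≫ e' X Y g := by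
    intro X' X Y f g
    obtain ⟨g, rfl⟩ := (e' X Y).symm.surjective g
    rw [← Equiv.eq_symm_apply, Equiv.apply_symm_apply, he', he', F.map_comp, Category.assoc]
  let adj := Adjunction.adjunctionOfEquivRight e' nat
  have : IsIso adj.counit := by
    have (W : B) : IsIso (adj.counit.app W) := by
      have : adj.counit.app W = (e W).some.hom := by
        simp [adj, he']
      rw [this]
      infer_instance
    exact NatIso.isIso_of_isIso_app _
  exact ⟨_, adj, adj.fullyFaithfulROfIsIsoCounit.full, adj.fullyFaithfulROfIsIsoCounit.faithful⟩

/-- An exact functor of abelian categories such that every object of the target embeds into the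
image of a closed object is a Serre quotient functor. -/
lemma isLocalization_isoModSerre_kernel {A B : Type*} [Category* A] [Category* B] [Abelian A]
    [Abelian B] (F : A ⥤ B) [PreservesFiniteLimits F] [PreservesFiniteColimits F]
    (h : ∀ W : B, ∃ (X : A) (i : W ⟶ F.obj X), IsClosedFor F X ∧ Mono i) :
    F.IsLocalization F.kernel.isoModSerre := by
  have h' : ∀ W : B, ∃ X : A, IsClosedFor F X ∧ Nonempty (F.obj X ≅ W) := by
    intro W
    obtain ⟨X₀, i, hX₀, _⟩ := h W
    obtain ⟨X₁, j, hX₁, _⟩ := h (cokernel i)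
    -- `W` is the kernel of `F X₀ ⟶ coker i ⟶ F X₁`. As `X₁` is closed, this composite is `F g`, so
    -- `W` is `F (ker g)` by left exactness.
    obtain ⟨g, hg⟩ := (hX₁ X₀).2 (cokernel.π i ≫ j)
    dsimp only at hg
    refine ⟨kernel g, IsClosedFor.of_isLimit (K := parallelPair g 0) ?_ (limit.isLimit _)
      (isLimitOfPreserves F (limit.isLimit _)), ⟨?_⟩⟩
    · rintro (_ | _) <;> assumption
    · refine (PreservesKernel.iso F g).trans ((kernelIsoOfEq hg).trans
        ((kernelCompMono _ _).trans ?_))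
      exact (kernelIsKernel (cokernel.π i)).conePointUniqueUpToIso
        (Abelian.monoIsKernelOfCokernel _ (colimit.isColimit _))
  obtain ⟨G, adj, _, _⟩ := exists_adjunction_of_isClosedFor h'
  exact Abelian.isLocalization_isoModSerre_kernel_of_leftAdjoint adj

end Localization

/-! ### Finite-dimensional modules and exactness of the Nakayama functor -/

section Exactness

variable (k : Type u) [Field k] (C : Type u) [SmallCategory C]

variable {k C} in
-- Finite-dimensionality depends only on the individual spaces, so no naturality is asked of the
-- maps; this covers quotients and submodules at once.
lemma isFD_of_surjective_or_injective {V W : CMod k C} (hV : isFD k C V)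
    (h : ∀ i, (∃ f : V.obj i →ₗ[k] W.obj i, Function.Surjective f) ∨
      ∃ f : W.obj i →ₗ[k] V.obj i, Function.Injective f) : isFD k C W := by
  have := hV.1
  refine ⟨fun i => ?_, hV.2.subset fun i hi => ?_⟩
  · obtain ⟨f, hf⟩ | ⟨f, hf⟩ := h i
    · exact Module.Finite.of_surjective f hf
    · exact Module.Finite.of_injective f hf
  · have : Nontrivial (W.obj i) := hi
    obtain ⟨f, hf⟩ | ⟨f, hf⟩ := h i
    · exact hf.nontrivial
    · exact hf.nontrivial

instance : (isFD k C).IsClosedUnderQuotients where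
  prop_of_epi f _ h := isFD_of_surjective_or_injective h fun i =>
    .inl ⟨(f.app i).hom, (ModuleCat.epi_iff_surjective _).1 inferInstance⟩

instance : (isFD k C).IsClosedUnderSubobjects where
  prop_of_mono f _ h := isFD_of_surjective_or_injective h fun i =>
    .inr ⟨(f.app i).hom, (ModuleCat.mono_iff_injective _).1 inferInstance⟩

instance : (isFD k C).ContainsZero where
  exists_zero := by
    obtain ⟨Z, hZ⟩ := HasZeroObject.zero (C := CMod k C)
    have h (i : C) : Subsingleton (Z.obj i) :=
      ModuleCat.subsingleton_of_isZero ((Functor.isZero_iff _).1 hZ i)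
    refine ⟨Z, hZ, ?_⟩
    refine ⟨fun i => inferInstance, Set.finite_empty.subset fun i hi => ?_⟩
    exact not_subsingleton_iff_nontrivial.2 hi (h i)

variable {k C} in
lemma isFD_biprod {V W : CMod k C} (hV : isFD k C V) (hW : isFD k C W) :
    isFD k C (V ⊞ W) := by
  have := hV.1
  have := hW.1
  let f (i : C) : (V ⊞ W : CMod k C).obj i →ₗ[k] V.obj i × W.obj i :=
    ((biprod.fst : V ⊞ W ⟶ V).app i).hom.prod ((biprod.snd : V ⊞ W ⟶ W).app i).hom
  have hf (i : C) : Function.Injective (f i) := by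
    rw [← LinearMap.ker_eq_bot, LinearMap.ker_eq_bot']
    intro x hx
    have e := congrArg (fun φ : V ⊞ W ⟶ V ⊞ W => (φ.app i).hom x)
      (biprod.total (X := V) (Y := W))
    have h₁ : (biprod.fst : V ⊞ W ⟶ V).app i x = 0 := congrArg Prod.fst hx
    have h₂ : (biprod.snd : V ⊞ W ⟶ W).app i x = 0 := congrArg Prod.snd hx
    have e' : (biprod.inl : V ⟶ V ⊞ W).app i ((biprod.fst : V ⊞ W ⟶ V).app i x) +
      (biprod.inr : W ⟶ V ⊞ W).app i ((biprod.snd : V ⊞ W ⟶ W).app i x) = x := e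
    rw [← e', h₁, h₂, map_zero, map_zero, add_zero]
  refine ⟨fun i => Module.Finite.of_injective _ (hf i), (hV.2.union hW.2).subset fun i hi => ?_⟩
  by_contra hcon
  rw [Set.mem_union, not_or] at hcon
  have := not_nontrivial_iff_subsingleton.1 hcon.1
  have := not_nontrivial_iff_subsingleton.1 hcon.2
  exact not_subsingleton_iff_nontrivial.2 hi (hf i).subsingleton

instance : (isFD k C).IsClosedUnderBinaryProducts where
  limitsOfShape_le := by
    rintro X ⟨p⟩
    have e : X ≅ p.diag.obj ⟨.left⟩ ⊞ p.diag.obj ⟨.right⟩ :=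
      (IsLimit.conePointsIsoOfNatIso p.isLimit (BinaryBiproduct.isLimit _ _)
        (diagramIsoPair p.diag))
    exact (isFD k C).prop_of_iso e.symm (isFD_biprod (p.prop_diag_obj _) (p.prop_diag_obj _))

instance : (isFD k C).IsClosedUnderFiniteProducts :=
  ObjectProperty.IsClosedUnderFiniteProducts.mk'

noncomputable instance : Abelian (FDMod k C) := inferInstance

section Inclusion

variable {A : Type*} [Category* A] [Abelian A] (P : ObjectProperty A) [P.ContainsZero]
  [P.IsClosedUnderKernels] [P.IsClosedUnderCokernels] [P.IsClosedUnderFiniteProducts]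

lemma preservesFiniteLimits_ι : PreservesFiniteLimits P.ι :=
  have := P.preservesKernels_ι
  Functor.preservesFiniteLimits_of_preservesKernels P.ι

lemma preservesFiniteColimits_ι : PreservesFiniteColimits P.ι :=
  have := P.preservesCokernels_ι
  Functor.preservesFiniteColimits_of_preservesCokernels P.ι

end Inclusion

/-- The functor `D ∘ Hom_C(-, A)` on all left modules. -/
noncomputable abbrev dualHomA : CMod k C ⥤ CMod k C :=
  (homA k C).rightOp ⋙ dual k C

instance (i : C) : (dualHomA k C ⋙ (evaluation C (ModuleCat.{u} k)).obj i).Additive where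
  map_add {V W f g} := by
    ext (x : Module.Dual k (V ⟶ (Ae k C).obj (op i)))
    exact LinearMap.ext fun y : W ⟶ (Ae k C).obj (op i) =>
      (congrArg x (Preadditive.add_comp _ _ _ f g y)).trans (map_add x _ _)

variable {k C}

/-- `Hom_C(-, A e_i)` is exact because `A e_i` is injective, and dualizing over a field is exact. -/
lemma shortExact_map_dualHomA (hinj : IsLocallySelfInjective k C) (i : C)
    (S : ShortComplex (CMod k C)) (hS : S.ShortExact) :
    (S.map (dualHomA k C ⋙ (evaluation C (ModuleCat.{u} k)).obj i)).ShortExact := by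
  have := hinj i
  let I := (Ae k C).obj (op i)
  have := hS.mono_f
  have := hS.epi_g
  let a : (S.X₂ ⟶ I) →ₗ[k] (S.X₁ ⟶ I) := Linear.leftComp k I S.f
  let b : (S.X₃ ⟶ I) →ₗ[k] (S.X₂ ⟶ I) := Linear.leftComp k I S.g
  have ha : Function.Surjective a := fun x =>
    ⟨Injective.factorThru x S.f, Injective.comp_factorThru x S.f⟩
  have hb : Function.Injective b := fun x y h => (cancel_epi S.g).1 h
  have hab : LinearMap.ker a = LinearMap.range b := by
    ext x
    refine ⟨fun hx => ⟨hS.exact.desc x hx, hS.exact.g_desc x hx⟩, ?_⟩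
    rintro ⟨y, rfl⟩
    exact S.zero_assoc y |>.trans zero_comp
  refine { exact := ?_, mono_f := ?_, epi_g := ?_ }
  · rw [ShortComplex.moduleCat_exact_iff_range_eq_ker]
    change LinearMap.range a.dualMap = LinearMap.ker b.dualMap
    rw [LinearMap.range_dualMap_eq_dualAnnihilator_ker,
      LinearMap.ker_dualMap_eq_dualAnnihilator_range, hab]
  · exact (ModuleCat.mono_iff_injective _).2 (LinearMap.dualMap_injective_of_surjective ha)
  · exact (ModuleCat.epi_iff_surjective _).2 (LinearMap.dualMap_surjective_of_injective hb)

lemma preserves_dualHomA (hinj : IsLocallySelfInjective k C) :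
    PreservesFiniteLimits (dualHomA k C) ∧ PreservesFiniteColimits (dualHomA k C) := by
  -- An additive functor preserving short exact sequences preserves finite limits and colimits; in a
  -- functor category these are tested objectwise.
  have h (i : C) := ((dualHomA k C ⋙ (evaluation C (ModuleCat.{u} k)).obj i).exact_tfae.out 0 3).1
    (shortExact_map_dualHomA hinj i)
  exact ⟨preservesFiniteLimits_of_evaluation _ fun i => (h i).1,
    preservesFiniteColimits_of_evaluation _ fun i => (h i).2⟩

variable [InwardsFinite C] [HomFinite C] [LocallyNoetherian k C]

lemma preservesFiniteLimits_nakayama (hinj : IsLocallySelfInjective k C) :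
    PreservesFiniteLimits (nakayama k C) := by
  have := (preserves_dualHomA hinj).1
  have := preservesFiniteLimits_ι (isFG k C)
  have := preservesFiniteLimits_ι (isFD k C)
  have : PreservesFiniteLimits (nakayama k C ⋙ (isFD k C).ι) :=
    inferInstanceAs (PreservesFiniteLimits ((isFG k C).ι ⋙ dualHomA k C))
  exact preservesFiniteLimits_of_reflects_of_preserves (nakayama k C) (isFD k C).ι

lemma preservesFiniteColimits_nakayama (hinj : IsLocallySelfInjective k C) :
    PreservesFiniteColimits (nakayama k C) := by
  have := (preserves_dualHomA hinj).2
  have := preservesFiniteColimits_ι (isFG k C)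
  have := preservesFiniteColimits_ι (isFD k C)
  have : PreservesFiniteColimits (nakayama k C ⋙ (isFD k C).ι) :=
    inferInstanceAs (PreservesFiniteColimits ((isFG k C).ι ⋙ dualHomA k C))
  exact preservesFiniteColimits_of_reflects_of_preserves (nakayama k C) (isFD k C).ι

end Exactness

/-! ### The projectives `A e_j` and the morphisms between them -/

section Projectives

variable {k : Type u} [Field k] {C : Type u} [SmallCategory C]

/-- The generator `e_j` of `A e_j`. -/
noncomputable def idem (k : Type u) [Field k] {C : Type u} [SmallCategory C] (j : C) :
    ((Ae k C).obj (op j)).obj j :=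
  ((Finsupp.single (𝟙 j) 1 : (j ⟶ j) →₀ k) :)

lemma Ae_map_single {i j l : C} (f : j ⟶ l) (h : i ⟶ j) (c : k) :
    (((Ae k C).obj (op i)).map f).hom (Finsupp.single h c : (i ⟶ j) →₀ k) =
      (Finsupp.single (h ≫ f) c : (i ⟶ l) →₀ k) :=
  Finsupp.mapDomain_single

lemma Ae_map_idem {j l : C} (f : j ⟶ l) :
    (((Ae k C).obj (op j)).map f).hom (idem k j) = (Finsupp.single f 1 : (j ⟶ l) →₀ k) :=
  (Ae_map_single f (𝟙 j) 1).trans (by rw [Category.id_comp])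

lemma span_Ae (j i : C) : Submodule.span k
    {x : ((Ae k C).obj (op j)).obj i | ∃ f : j ⟶ i,
      (((Ae k C).obj (op j)).map f).hom (idem k j) = x} = ⊤ := by
  refine Eq.trans ?_ (Finsupp.basisSingleOne (R := k) (ι := j ⟶ i)).span_eq
  congr 1
  ext x
  refine exists_congr fun f => ?_
  rw [Ae_map_idem, Finsupp.coe_basisSingleOne]
  rfl

lemma isFG_Ae (j : C) : isFG k C ((Ae k C).obj (op j)) := by
  refine ⟨PUnit, inferInstance, fun _ => j, fun _ => idem k j, fun i => ?_⟩
  rw [← span_Ae j i]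
  congr 1
  ext x
  exact ⟨fun ⟨_, f, h⟩ => ⟨f, h⟩, fun ⟨f, h⟩ => ⟨⟨⟩, f, h⟩⟩

lemma Ae_hom_ext {j : C} {M : CMod k C} {f g : (Ae k C).obj (op j) ⟶ M}
    (h : (f.app j).hom (idem k j) = (g.app j).hom (idem k j)) : f = g := by
  ext i : 2
  apply ModuleCat.hom_ext
  apply LinearMap.ext_on (span_Ae j i)
  rintro _ ⟨s, rfl⟩
  have e₁ := NatTrans.naturality_apply f s (idem k j)
  have e₂ := NatTrans.naturality_apply g s (idem k j)
  exact e₁.trans ((congrArg (M.map s).hom h).trans e₂.symm)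

/-- A morphism `A e_j ⟶ A e_i` as an element of `e_i A e_j`. -/
noncomputable def coeff (k : Type u) [Field k] {C : Type u} [SmallCategory C] (i j : C) :
    ((Ae k C).obj (op j) ⟶ (Ae k C).obj (op i)) →ₗ[k] ((i ⟶ j) →₀ k) where
  toFun g := (g.app j).hom (idem k j)
  map_add' _ _ := rfl
  map_smul' _ _ := rfl

lemma coeff_injective (i j : C) : Function.Injective (coeff k i j) :=
  fun _ _ h => Ae_hom_ext h

lemma coeff_Ae_map {i j : C} (f : i ⟶ j) :
    coeff k i j ((Ae k C).map f.op) = Finsupp.single f 1 :=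
  (Finsupp.mapDomain_single (f := fun h : j ⟶ j => f ≫ h)).trans (by rw [Category.comp_id])

/-- Every morphism `A e_j ⟶ A e_i` is a linear combination of right multiplications by morphisms
`i ⟶ j`. -/
lemma span_Ae_hom (i j : C) : Submodule.span k
    (Set.range fun f : i ⟶ j => (Ae k C).map f.op) = ⊤ := by
  refine eq_top_iff.2 fun g _ => ?_
  have h : coeff k i j g ∈ Submodule.map (coeff k i j) (Submodule.span k
      (Set.range fun f : i ⟶ j => (Ae k C).map f.op)) := by
    rw [Submodule.map_span, ← Set.range_comp]
    have e : (coeff k i j ∘ fun f : i ⟶ j => (Ae k C).map f.op) = Finsupp.basisSingleOne (R := k) := by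
      ext1 f
      rw [Finsupp.coe_basisSingleOne]
      exact coeff_Ae_map f
    rw [e, Module.Basis.span_eq]
    trivial
  obtain ⟨g', hg', e⟩ := h
  exact coeff_injective i j e ▸ hg'

end Projectives

/-! ### The modules `A e_j` are closed and their images cogenerate -/

section Closed

variable {k : Type u} [Field k] {C : Type u} [SmallCategory C]

/-- The action of `k C(i, j)` from `W i` to `W j`, followed by a linear form on `W j`. -/
noncomputable def formComp (W : CMod k C) {j : C} (l : Module.Dual k (W.obj j)) (i : C) :
    ((i ⟶ j) →₀ k) →ₗ[k] Module.Dual k (W.obj i) :=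
  Finsupp.linearCombination k fun h => l ∘ₗ (W.map h).hom

lemma formComp_mapDomain (W : CMod k C) {j : C} (l : Module.Dual k (W.obj j)) {i i' : C}
    (f : i ⟶ i') (x : (i' ⟶ j) →₀ k) (w : W.obj i) :
    formComp W l i (Finsupp.mapDomain (fun h => f ≫ h) x) w =
      formComp W l i' x ((W.map f).hom w) := by
  induction x using Finsupp.induction_linear with
  | zero => simp
  | add x y hx hy => rw [Finsupp.mapDomain_add, map_add, map_add, LinearMap.add_apply, hx, hy,
      LinearMap.add_apply]
  | single h c => simp [formComp, Finsupp.mapDomain_single]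

/-- The morphism `W ⟶ D Hom_C(A e_j, A)` corresponding to a linear form on `W j`. -/
noncomputable def toDualHomA (W : CMod k C) (j : C) (l : Module.Dual k (W.obj j)) :
    W ⟶ (dualHomA k C).obj ((Ae k C).obj (op j)) where
  app i := ModuleCat.ofHom ((coeff k i j).dualMap ∘ₗ (formComp W l i).flip)
  naturality i i' f := by
    ext w
    exact LinearMap.ext fun g : (Ae k C).obj (op j) ⟶ (Ae k C).obj (op i') =>
      (formComp_mapDomain W l f (coeff k i' j g) w).symm

/-- Evaluation at the identity, a linear form on `D Hom_C(A e_j, A) j`. -/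
noncomputable def evalId (j : C) :
    Module.Dual k (((dualHomA k C).obj ((Ae k C).obj (op j))).obj j) :=
  Module.Dual.eval k ((Ae k C).obj (op j) ⟶ (Ae k C).obj (op j)) (𝟙 _)

/-- The form `l` is recovered from its morphism, so a vector killed by the morphism is killed by
`l`. -/
lemma evalId_toDualHomA (W : CMod k C) (j : C) (l : Module.Dual k (W.obj j)) (w : W.obj j) :
    evalId j (((toDualHomA W j l).app j).hom w) = l w := by
  change formComp W l j (Finsupp.single (𝟙 j) 1) w = l w
  simp [formComp]

/-- Morphisms `W ⟶ D Hom_C(A e_j, A)` are determined by the corresponding linear form on `W j`. -/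
lemma dualHomA_Ae_hom_ext {W : CMod k C} {j : C}
    {φ ψ : W ⟶ (dualHomA k C).obj ((Ae k C).obj (op j))}
    (h : ∀ w, evalId j ((φ.app j).hom w) = evalId j ((ψ.app j).hom w)) : φ = ψ := by
  -- Yoneda argument: naturality along `f` reduces the value at right multiplication by `f` to a
  -- value at the identity.
  have key (χ : W ⟶ (dualHomA k C).obj ((Ae k C).obj (op j))) (i : C) (w : W.obj i) (f : i ⟶ j) :
      (show Module.Dual k ((Ae k C).obj (op j) ⟶ (Ae k C).obj (op i)) from (χ.app i).hom w)
        ((Ae k C).map f.op) = evalId j ((χ.app j).hom ((W.map f).hom w)) := by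
    have e := congrArg (evalId j) (NatTrans.naturality_apply χ f w)
    refine Eq.trans ?_ e.symm
    change _ = (show Module.Dual k ((Ae k C).obj (op j) ⟶ (Ae k C).obj (op i)) from
      (χ.app i).hom w) (𝟙 _ ≫ (Ae k C).map f.op)
    rw [Category.id_comp]
  ext i w
  refine LinearMap.ext_on (span_Ae_hom i j) ?_
  rintro _ ⟨f, rfl⟩
  exact (key φ i w f).trans ((h _).trans (key ψ i w f).symm)

/-- Under evaluation at the identity, `f` goes to "evaluate at `f`" in the double dual of `Hom_C(V,
A e_j)`, and finite-dimensional spaces are reflexive. -/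
lemma map_dualHomA_bijective [InwardsFinite C] [HomFinite C] {V : CMod k C} (hV : isFG k C V)
    (j : C) : Function.Bijective (fun f : V ⟶ (Ae k C).obj (op j) => (dualHomA k C).map f) := by
  have : Module.Finite k (V ⟶ (Ae k C).obj (op j)) := (isFD_homA hV).1 (op j)
  have key (f : V ⟶ (Ae k C).obj (op j)) (x : Module.Dual k (V ⟶ (Ae k C).obj (op j))) :
      evalId j ((((dualHomA k C).map f).app j).hom x) = x f :=
    congrArg x (Category.comp_id f)
  refine ⟨fun f g h => ?_, fun φ => ?_⟩
  · apply (Module.evalEquiv k (V ⟶ (Ae k C).obj (op j))).injective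
    ext x
    dsimp only at h
    have e : evalId j ((((dualHomA k C).map f).app j).hom x) =
        evalId j ((((dualHomA k C).map g).app j).hom x) := by rw [h]
    exact (key f x).symm.trans (e.trans (key g x))
  · obtain ⟨f, hf⟩ := (Module.evalEquiv k (V ⟶ (Ae k C).obj (op j))).surjective
      (evalId j ∘ₗ (φ.app j).hom)
    refine ⟨f, dualHomA_Ae_hom_ext fun x => (key f x).trans ?_⟩
    exact LinearMap.congr_fun hf x

variable [InwardsFinite C] [HomFinite C]

lemma isClosedFor_Ae (j : C) :
    IsClosedFor (nakayama k C) ⟨(Ae k C).obj (op j), isFG_Ae j⟩ := by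
  intro V
  have h := map_dualHomA_bijective V.property j
  refine ⟨fun f g e => ?_, fun φ => ?_⟩
  · exact (isFG k C).ι.map_injective (h.1 (congrArg (isFD k C).ι.map e))
  · obtain ⟨f, hf⟩ := h.2 φ.hom
    exact ⟨(isFG k C).homMk f, (isFD k C).ι.map_injective hf⟩

lemma exists_mono_nakayama [LocallyNoetherian k C] (hinj : IsLocallySelfInjective k C)
    (W : FDMod k C) : ∃ (X : FGMod k C) (i : W ⟶ (nakayama k C).obj X),
      IsClosedFor (nakayama k C) X ∧ Mono i := by
  have := preservesFiniteLimits_nakayama hinj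
  have hW := W.property
  have hS : Finite {i : C | Nontrivial (W.obj.obj i)} := hW.2
  have := hW.1
  -- Indexes a basis of the total space of `W`: one factor `A e_t` for each basis vector of `W t`.
  let ι := Σ t : {i : C | Nontrivial (W.obj.obj i)}, Fin (Module.finrank k (W.obj.obj t.1))
  obtain ⟨n, ⟨e⟩⟩ := Finite.exists_equiv_fin ι
  let P (s : Fin n) : FGMod k C := ⟨(Ae k C).obj (op (e.symm s).1.1), isFG_Ae _⟩
  let φ (s : Fin n) : W ⟶ (nakayama k C).obj (P s) := (isFD k C).homMk
    (toDualHomA W.obj (e.symm s).1.1 ((Module.finBasis k _).coord (e.symm s).2))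
  let i : W ⟶ (nakayama k C).obj (∏ᶜ P) :=
    Pi.lift φ ≫ (PreservesProduct.iso (nakayama k C) P).inv
  have hi : Mono i := by
    have : Mono (Pi.lift φ) := by
      have := preservesFiniteLimits_ι (isFD k C)
      refine (isFD k C).ι.mono_of_mono_map ?_
      rw [NatTrans.mono_iff_mono_app]
      intro c
      rw [ModuleCat.mono_iff_injective, ← LinearMap.ker_eq_bot, LinearMap.ker_eq_bot']
      intro w hw
      -- Project to the factor indexed by `t` and evaluate at the identity to read off the
      -- coordinate.
      have key (t : ι) (w : W.obj.obj t.1) (hw : ((Pi.lift φ).hom.app t.1).hom w = 0) :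
          (Module.finBasis k _).coord t.2 w = 0 := by
        obtain ⟨s, rfl⟩ := e.symm.surjective t
        have h : (Pi.lift φ).hom ≫ (Pi.π _ s : ∏ᶜ (fun s => (nakayama k C).obj (P s)) ⟶ _).hom =
            toDualHomA W.obj (e.symm s).1.1 ((Module.finBasis k _).coord (e.symm s).2) :=
          congrArg (isFD k C).ι.map (Pi.lift_π φ s)
        rw [← evalId_toDualHomA W.obj, ← h]
        refine (congrArg (fun x => evalId _ ((Pi.π _ s :
          ∏ᶜ (fun s => (nakayama k C).obj (P s)) ⟶ _).hom.app _ |>.hom x)) hw).trans ?_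
        exact (congrArg _ (map_zero _)).trans (map_zero _)
      by_cases hc : Nontrivial (W.obj.obj c)
      · refine (Module.finBasis k (W.obj.obj c)).ext_elem fun b => ?_
        rw [map_zero]
        exact key ⟨⟨c, hc⟩, b⟩ w hw
      · have : Subsingleton (W.obj.obj c) := not_nontrivial_iff_subsingleton.1 hc
        exact Subsingleton.elim (α := W.obj.obj c) _ _
    infer_instance
  exact ⟨∏ᶜ P, i, IsClosedFor.of_isLimit (fun s => isClosedFor_Ae _) (limit.isLimit _)
    (isLimitOfPreserves _ (limit.isLimit _)), hi⟩

end Closed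

end EICat

theorem mainTheorem1 (k : Type u) [Field k] [CharZero k] (C : Type u) [SmallCategory C]
    (hskel : Skeletal C) (hEI : EICat.IsEI C) [EICat.InwardsFinite C] [EICat.HomFinite C]
    [EICat.LocallyNoetherian k C] (hinj : EICat.IsLocallySelfInjective k C) :
    ∃ _ : (EICat.nakayama k C).kernel.IsSerreClass,
      ∃ e : EICat.SerreQuotient (EICat.nakayama k C).kernel ≌ EICat.FDMod k C,
        Nonempty (EICat.toSerreQuotient (EICat.nakayama k C).kernel ⋙ e.functor ≅
          EICat.nakayama k C) := by
  have := EICat.preservesFiniteLimits_nakayama hinj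
  have := EICat.preservesFiniteColimits_nakayama hinj
  have := EICat.isLocalization_isoModSerre_kernel (EICat.nakayama k C)
    (EICat.exists_mono_nakayama hinj)
  let W := (EICat.nakayama k C).kernel.isoModSerre
  exact ⟨inferInstance, Localization.uniq W.Q (EICat.nakayama k C) W,
    ⟨Localization.compUniqFunctor W.Q (EICat.nakayama k C) W⟩⟩
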